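/- Let $\sigma\in\mathbb{R}$, let $\Omega=\mathbb{C}\setminus\mathbb{R}$, let $X_0$ be a Borel probability measure on $\mathbb{R}$, and put $f(w)=\int\frac{dX_0(x)}{x-w}$ for $w\in\Omega$. Let $\{X_t\}_{t\ge 0}$ be the family of Borel probability measures on $\mathbb{R}$ that is characterized by the property that its Stieltjes transform $M(t,z)=\int\frac{dX_t(x)}{x-z}$, $t\ge 0$, $z\in\Omega$, is a classical solution, continuous in $t\in[0,\infty)$ for each $z\in\Omega$, of the initial value problem $$\frac{\partial M}{\partial t}=(2\sigma^2M+z)\frac{\partial M}{\partial z}+M\quad (t>0,\ z\in\Omega),\qquad M(0,z)=f(z)\quad(z\in\Omega).$$ For $t\ge 0$ define, for $z,w\in\Omega$, $$h_t(z)=ze^t+\sigma^2(e^t-e^{-t})M(t,z),\qquad g_t(w)=e^{-t}w-\sigma^2(e^t-e^{-t})f(w).$$ Then for every $t\ge 0$ we have $h_t(\Omega)\subseteq\Omega$ and $g_t\circ h_t=\mathrm{id}$ on $\Omega$. Moreover, for $t_1\ge t_2\ge 0$ put $h_{t_1}^{t_2}=g_{t_2}\circ h_{t_1}$. Then $h_{t_1}^{t_2}(\Omega)\subseteq\Omega$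 and $h_{t_1}=h_{t_2}\circ h_{t_1}^{t_2}$ on $\Omega$. -/

import Mathlib

open MeasureTheory

noncomputable section

namespace DysonFlow

/-- The domain `Ω = ℂ ∖ ℝ`. -/
def Omega : Set ℂ := {z : ℂ | z.im ≠ 0}

/-- The Stieltjes transform `z ↦ ∫ dμ(x) / (x - z)` of a Borel probability measure on `ℝ`.
It is used only for `z ∈ Ω`, where the integrand is bounded. -/
def stieltjes (μ : ProbabilityMeasure ℝ) (z : ℂ) : ℂ :=
  ∫ x : ℝ, 1 / ((x : ℂ) - z) ∂(μ : Measure ℝ)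

/-- The family `(X t)`, `t ≥ 0`, is the limiting evolution started from `X₀`: its Stieltjes
transform `M (t, z) = ∫ d(X t)(x) / (x - z)`, `z ∈ Ω`, is a classical solution of the initial
value problem `∂M/∂t = (2 σ² M + z) ∂M/∂z + M` for `t > 0`, `M (0, z) = ∫ dX₀(x) / (x - z)`,
continuous in time up to `t = 0`.
Nothing is required of `X t` for `t < 0`; these values are never used. -/
structure IsLimitFamily (σ : ℝ) (X₀ : ProbabilityMeasure ℝ)
    (X : ℝ → ProbabilityMeasure ℝ) : Prop where
  initial : ∀ z ∈ Omega, stieltjes (X 0) z = stieltjes X₀ z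
  continuousOn : ∀ z ∈ Omega, ContinuousOn (fun t : ℝ => stieltjes (X t) z) (Set.Ici 0)
  equation : ∀ t : ℝ, 0 < t → ∀ z ∈ Omega,
    HasDerivAt (fun s : ℝ => stieltjes (X s) z)
      ((2 * (σ : ℂ) ^ 2 * stieltjes (X t) z + z) * deriv (stieltjes (X t)) z
        + stieltjes (X t) z) t

/-- `h_t(z) = z e^t + σ² (e^t - e^{-t}) M(t, z)`. -/
def h (σ : ℝ) (X : ℝ → ProbabilityMeasure ℝ) (t : ℝ) (z : ℂ) : ℂ :=
  z * (Real.exp t : ℂ)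
    + (σ : ℂ) ^ 2 * ((Real.exp t : ℂ) - (Real.exp (-t) : ℂ)) * stieltjes (X t) z

/-- `g_t(w) = e^{-t} w - σ² (e^t - e^{-t}) f(w)`, `f` the Stieltjes transform of `X₀`. -/
def g (σ : ℝ) (X₀ : ProbabilityMeasure ℝ) (t : ℝ) (w : ℂ) : ℂ :=
  (Real.exp (-t) : ℂ) * w
    - (σ : ℂ) ^ 2 * ((Real.exp t : ℂ) - (Real.exp (-t) : ℂ)) * stieltjes X₀ w

/-- `h_{t₁}^{t₂} = g_{t₂} ∘ h_{t₁}`. -/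
def hTrans (σ : ℝ) (X₀ : ProbabilityMeasure ℝ) (X : ℝ → ProbabilityMeasure ℝ)
    (t₁ t₂ : ℝ) : ℂ → ℂ :=
  g σ X₀ t₂ ∘ h σ X t₁

end DysonFlow

end

/-!
The proof is the method of characteristics, run backward in time. Fix `t` and `z ∈ Ω` and put
`m = M (t, z)`. If the solution grows like `e^s` along a characteristic, then the one through
`(t, z)` is the explicit curve
`ζ s = e^{t - s} z + σ² (e^{t - s} - e^{s - t}) m` (`DysonFlow.characteristic`). As a Stieltjes
transform maps each half plane into itself, `ζ` moves away from the real axis as `s` decreases, so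
it stays in `Ω` for all `s ≤ t`. By the equation, `φ s = M (s, ζ s) - m e^{s - t}` satisfies
`φ' = (2 σ² ∂M/∂z + 1) φ` on `(0, t]` and `φ t = 0`; since `|∂M/∂z| ≤ |Im z|⁻²` along the curve,
Grönwall's inequality gives `φ = 0`, that is, `M (s, ζ s) = e^{s - t} m`
(`DysonFlow.IsLimitFamily.stieltjes_characteristic`).

The chain rule behind this (`DysonFlow.hasDerivAt_stieltjes_comp`) needs `∂M/∂z` to be continuous
in time, which is not part of the hypothesis. It follows because the difference quotients of
Stieltjes transforms of probability measures converge uniformly in the measure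
(`DysonFlow.norm_stieltjesDivDiff_sub_le`).

Finally `h_t(z) = ζ 0`, and inserting `f (ζ 0) = e^{-t} m` into `g_s` gives `g_s (h_t(z)) = ζ s`
for every `s`; all the claims are read off from this.
-/

open MeasureTheory

noncomputable section

namespace DysonFlow

open Filter Topology

/-! ### Stieltjes transforms and their divided differences -/

/-- The divided difference `∫ dμ(x) / ((x - z) (x - w))` of the Stieltjes transform at `z`, `w`;
on the diagonal it is the derivative. -/
def stieltjesDivDiff (μ : ProbabilityMeasure ℝ) (z w : ℂ) : ℂ :=
  ∫ x : ℝ, 1 / (((x : ℂ) - z) * ((x : ℂ) - w)) ∂(μ : Measure ℝ)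

theorem abs_im_le_norm_ofReal_sub (x : ℝ) (z : ℂ) : |z.im| ≤ ‖(x : ℂ) - z‖ := by
  simpa using Complex.abs_im_le_norm ((x : ℂ) - z)

theorem ofReal_sub_ne_zero {z : ℂ} (hz : z ∈ Omega) (x : ℝ) : (x : ℂ) - z ≠ 0 :=
  norm_pos_iff.mp ((abs_pos.mpr hz).trans_le (abs_im_le_norm_ofReal_sub x z))

theorem norm_one_div_ofReal_sub_le {z : ℂ} (hz : z ∈ Omega) (x : ℝ) :
    ‖1 / ((x : ℂ) - z)‖ ≤ 1 / |z.im| := by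
  rw [norm_div, norm_one]
  exact one_div_le_one_div_of_le (abs_pos.mpr hz) (abs_im_le_norm_ofReal_sub x z)

theorem norm_one_div_mul_ofReal_sub_le {z w : ℂ} (hz : z ∈ Omega) (hw : w ∈ Omega) (x : ℝ) :
    ‖1 / (((x : ℂ) - z) * ((x : ℂ) - w))‖ ≤ 1 / (|z.im| * |w.im|) := by
  rw [norm_div, norm_one, norm_mul]
  have hz' := abs_pos.mpr hz
  have hw' := abs_pos.mpr hw
  gcongr
  exacts [abs_im_le_norm_ofReal_sub x z, abs_im_le_norm_ofReal_sub x w]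

theorem integrable_one_div_ofReal_sub (μ : ProbabilityMeasure ℝ) {z : ℂ} (hz : z ∈ Omega) :
    Integrable (fun x : ℝ => 1 / ((x : ℂ) - z)) (μ : Measure ℝ) :=
  Integrable.of_bound (Measurable.aestronglyMeasurable (by fun_prop)) _
    (Eventually.of_forall (norm_one_div_ofReal_sub_le hz))

theorem integrable_one_div_mul_ofReal_sub (μ : ProbabilityMeasure ℝ) {z w : ℂ}
    (hz : z ∈ Omega) (hw : w ∈ Omega) :
    Integrable (fun x : ℝ => 1 / (((x : ℂ) - z) * ((x : ℂ) - w))) (μ : Measure ℝ) :=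
  Integrable.of_bound (Measurable.aestronglyMeasurable (by fun_prop)) _
    (Eventually.of_forall (norm_one_div_mul_ofReal_sub_le hz hw))

/-- The Stieltjes transform preserves the upper and the lower half plane, up to the boundary. -/
theorem im_mul_im_stieltjes_nonneg (μ : ProbabilityMeasure ℝ) {z : ℂ} (hz : z ∈ Omega) :
    0 ≤ z.im * (stieltjes μ z).im := by
  have him : (stieltjes μ z).im = ∫ x : ℝ, (1 / ((x : ℂ) - z)).im ∂(μ : Measure ℝ) :=
    ((RCLike.imCLM (K := ℂ)).integral_comp_comm (integrable_one_div_ofReal_sub μ hz)).symm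
  rw [him, ← integral_const_mul]
  refine integral_nonneg fun x => ?_
  have : z.im * (1 / ((x : ℂ) - z)).im = z.im ^ 2 / Complex.normSq ((x : ℂ) - z) := by
    simp
    ring
  rw [this]
  exact div_nonneg (sq_nonneg _) (Complex.normSq_nonneg _)

theorem stieltjes_sub (μ : ProbabilityMeasure ℝ) {z w : ℂ} (hz : z ∈ Omega) (hw : w ∈ Omega) :
    stieltjes μ w - stieltjes μ z = (w - z) * stieltjesDivDiff μ z w := by
  unfold stieltjes stieltjesDivDiff
  rw [← integral_sub (integrable_one_div_ofReal_sub μ hw) (integrable_one_div_ofReal_sub μ hz),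
    ← integral_const_mul]
  refine integral_congr_ae (Eventually.of_forall fun x => ?_)
  have h₁ := ofReal_sub_ne_zero hz x
  have h₂ := ofReal_sub_ne_zero hw x
  simp only
  field_simp
  ring

theorem norm_stieltjesDivDiff_le (μ : ProbabilityMeasure ℝ) {z w : ℂ}
    (hz : z ∈ Omega) (hw : w ∈ Omega) :
    ‖stieltjesDivDiff μ z w‖ ≤ 1 / (|z.im| * |w.im|) := by
  simpa [stieltjesDivDiff] using norm_integral_le_of_norm_le_const (μ := (μ : Measure ℝ))
    (Eventually.of_forall (norm_one_div_mul_ofReal_sub_le hz hw))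

/-- The divided difference approaches its diagonal value at a rate that does not depend on the
measure. -/
theorem norm_stieltjesDivDiff_sub_le (μ : ProbabilityMeasure ℝ) {z w : ℂ}
    (hz : z ∈ Omega) (hw : w ∈ Omega) :
    ‖stieltjesDivDiff μ z w - stieltjesDivDiff μ z z‖
      ≤ ‖w - z‖ * (1 / |z.im| * (1 / (|z.im| * |w.im|))) := by
  unfold stieltjesDivDiff
  rw [← integral_sub (integrable_one_div_mul_ofReal_sub μ hz hw)
    (integrable_one_div_mul_ofReal_sub μ hz hz)]
  have key : ∀ x : ℝ, ‖1 / (((x : ℂ) - z) * ((x : ℂ) - w)) - 1 / (((x : ℂ) - z) * ((x : ℂ) - z))‖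
      ≤ ‖w - z‖ * (1 / |z.im| * (1 / (|z.im| * |w.im|))) := fun x => by
    have h₁ := ofReal_sub_ne_zero hz x
    have h₂ := ofReal_sub_ne_zero hw x
    have : 1 / (((x : ℂ) - z) * ((x : ℂ) - w)) - 1 / (((x : ℂ) - z) * ((x : ℂ) - z))
        = (w - z) * (1 / ((x : ℂ) - z) * (1 / (((x : ℂ) - z) * ((x : ℂ) - w)))) := by
      field_simp
      ring
    rw [this, norm_mul, norm_mul]
    have h₃ := norm_one_div_ofReal_sub_le hz x
    have h₄ := norm_one_div_mul_ofReal_sub_le hz hw x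
    gcongr
  simpa using norm_integral_le_of_norm_le_const (μ := (μ : Measure ℝ)) (Eventually.of_forall key)

theorem isOpen_Omega : IsOpen Omega :=
  isOpen_ne_fun Complex.continuous_im continuous_const

/-- Along a convergent curve of points and an arbitrary curve of measures, the divided
difference is asymptotic to its diagonal value. -/
theorem tendsto_stieltjesDivDiff_sub {ι : Type*} {l : Filter ι} (Y : ι → ProbabilityMeasure ℝ)
    {ζ : ι → ℂ} {z : ℂ} (hz : z ∈ Omega) (hζ : Tendsto ζ l (𝓝 z)) :
    Tendsto (fun i => stieltjesDivDiff (Y i) z (ζ i) - stieltjesDivDiff (Y i) z z) l (𝓝 0) := by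
  have hz' : |z.im| ≠ 0 := abs_ne_zero.mpr hz
  have hlim : Tendsto (fun i => ‖ζ i - z‖ * (1 / |z.im| * (1 / (|z.im| * |(ζ i).im|)))) l
      (𝓝 (‖z - z‖ * (1 / |z.im| * (1 / (|z.im| * |z.im|))))) := by
    have him : Tendsto (fun i => |(ζ i).im|) l (𝓝 |z.im|) :=
      ((Complex.continuous_im.tendsto z).comp hζ).abs
    exact (hζ.sub_const z).norm.mul (tendsto_const_nhds.mul
      (tendsto_const_nhds.div (tendsto_const_nhds.mul him) (mul_ne_zero hz' hz')))
  rw [sub_self, norm_zero, zero_mul] at hlim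
  refine squeeze_zero_norm' ?_ hlim
  filter_upwards [hζ.eventually (isOpen_Omega.mem_nhds hz)] with i hi
  exact norm_stieltjesDivDiff_sub_le (Y i) hz hi

theorem hasDerivAt_stieltjes (μ : ProbabilityMeasure ℝ) {z : ℂ} (hz : z ∈ Omega) :
    HasDerivAt (stieltjes μ) (stieltjesDivDiff μ z z) z := by
  rw [hasDerivAt_iff_tendsto_slope]
  have hlim := (tendsto_stieltjesDivDiff_sub (fun _ : ℂ => μ) hz
    (tendsto_id.mono_left nhdsWithin_le_nhds : Tendsto id (𝓝[≠] z) (𝓝 z))).add_const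
      (stieltjesDivDiff μ z z)
  simp only [sub_add_cancel, zero_add, id] at hlim
  refine hlim.congr' ?_
  filter_upwards [self_mem_nhdsWithin,
    nhdsWithin_le_nhds (isOpen_Omega.mem_nhds hz)] with w hne hw
  rw [slope_def_field, stieltjes_sub μ hz hw, mul_div_cancel_left₀ _ (sub_ne_zero.mpr hne)]

/-! ### Differentiation along a curve -/

/-- If the Stieltjes transforms of a family of measures are continuous in time, so are their
spatial derivatives: these are uniform limits of difference quotients. -/
theorem continuousAt_stieltjesDivDiff {Y : ℝ → ProbabilityMeasure ℝ} {s : ℝ}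
    (hY : ∀ z ∈ Omega, ContinuousAt (fun r => stieltjes (Y r) z) s) {z : ℂ} (hz : z ∈ Omega) :
    ContinuousAt (fun r => stieltjesDivDiff (Y r) z z) s := by
  have hz' : 0 < |z.im| := abs_pos.mpr hz
  refine continuousAt_of_locally_uniform_approx_of_continuousAt fun u hu => ?_
  obtain ⟨ε, hε, hεu⟩ := Metric.mem_uniformity_dist.mp hu
  -- A real increment `η` keeps the imaginary part, so `ε * |z.im| ^ 3 / 2` suffices.
  set η : ℝ := ε * |z.im| ^ 3 / 2 with hη
  have hη0 : 0 < η := by positivity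
  have him : (z + η).im = z.im := by simp
  have hw : z + η ∈ Omega := by
    change (z + η).im ≠ 0
    rw [him]
    exact hz
  have hquot : ∀ r, (stieltjes (Y r) (z + η) - stieltjes (Y r) z) / η
      = stieltjesDivDiff (Y r) z (z + η) := fun r => by
    rw [stieltjes_sub (Y r) hz hw, add_sub_cancel_left,
      mul_div_cancel_left₀ _ (Complex.ofReal_ne_zero.mpr hη0.ne')]
  refine ⟨Set.univ, univ_mem, fun r => (stieltjes (Y r) (z + η) - stieltjes (Y r) z) / η,
    ((hY _ hw).sub (hY _ hz)).div_const _, fun r _ => hεu ?_⟩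
  simp only [hquot]
  rw [dist_comm, dist_eq_norm]
  refine (norm_stieltjesDivDiff_sub_le (Y r) hz hw).trans_lt ?_
  rw [him, add_sub_cancel_left, Complex.norm_real, Real.norm_of_nonneg hη0.le, hη]
  have : ε * |z.im| ^ 3 / 2 * (1 / |z.im| * (1 / (|z.im| * |z.im|))) = ε / 2 := by
    field_simp
  linarith

/-- The chain rule for `r ↦ M (r, ζ r)`. -/
theorem hasDerivAt_stieltjes_comp {Y : ℝ → ProbabilityMeasure ℝ} {s : ℝ}
    (hY : ∀ z ∈ Omega, ContinuousAt (fun r => stieltjes (Y r) z) s) {ζ : ℝ → ℂ} {ζ' m' : ℂ}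
    (hζ : HasDerivAt ζ ζ' s) (hs : ζ s ∈ Omega)
    (hm : HasDerivAt (fun r => stieltjes (Y r) (ζ s)) m' s) :
    HasDerivAt (fun r => stieltjes (Y r) (ζ r))
      (m' + ζ' * stieltjesDivDiff (Y s) (ζ s) (ζ s)) s := by
  have hQ : Tendsto (fun r => stieltjesDivDiff (Y r) (ζ s) (ζ r)) (𝓝 s)
      (𝓝 (stieltjesDivDiff (Y s) (ζ s) (ζ s))) := by
    simpa using (tendsto_stieltjesDivDiff_sub Y hs hζ.continuousAt.tendsto).add
      (continuousAt_stieltjesDivDiff hY hs).tendsto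
  have hev : ∀ᶠ r in 𝓝 s, ζ r ∈ Omega :=
    hζ.continuousAt.eventually_mem (isOpen_Omega.mem_nhds hs)
  rw [hasDerivAt_iff_tendsto_slope] at hζ hm ⊢
  refine (hm.add (hζ.mul (hQ.mono_left nhdsWithin_le_nhds))).congr' ?_
  filter_upwards [nhdsWithin_le_nhds hev] with r hr
  have hsub := stieltjes_sub (Y r) hs hr
  simp only [slope_def_module, smul_mul_assoc, ← smul_add, ← hsub]
  congr 1
  ring

/-! ### The backward characteristics -/

/-- The point at time `s` of the characteristic of the equation that passes at time `t` through
`z`, with `m` the value of the solution there: the solution of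
`ζ' = -(ζ + 2 σ² m e^{s - t})`, `ζ t = z`. -/
def characteristic (σ t : ℝ) (z m : ℂ) (s : ℝ) : ℂ :=
  (Real.exp (t - s) : ℂ) * z
    + (σ : ℂ) ^ 2 * ((Real.exp (t - s) : ℂ) - (Real.exp (s - t) : ℂ)) * m

theorem hasDerivAt_ofReal_exp_sub (t s : ℝ) :
    HasDerivAt (fun r : ℝ => (Real.exp (r - t) : ℂ)) (Real.exp (s - t) : ℂ) s := by
  simpa using ((hasDerivAt_id s).sub_const t).exp.ofReal_comp

theorem hasDerivAt_ofReal_exp_sub' (t s : ℝ) :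
    HasDerivAt (fun r : ℝ => (Real.exp (t - r) : ℂ)) (-(Real.exp (t - s) : ℂ)) s := by
  simpa using ((hasDerivAt_id s).const_sub t).exp.ofReal_comp

theorem hasDerivAt_characteristic (σ t : ℝ) (z m : ℂ) (s : ℝ) :
    HasDerivAt (characteristic σ t z m)
      (-(2 * (σ : ℂ) ^ 2 * (m * (Real.exp (s - t) : ℂ)) + characteristic σ t z m s)) s := by
  have h₁ := hasDerivAt_ofReal_exp_sub t s
  have h₂ := hasDerivAt_ofReal_exp_sub' t s
  refine ((h₂.mul_const z).add (((h₂.sub h₁).const_mul ((σ : ℂ) ^ 2)).mul_const m)).congr_deriv ?_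
  unfold characteristic
  ring

/-- Backward in time, a characteristic moves away from the real axis, provided that `m` points
into the same half plane as `z`. -/
theorem abs_im_le_abs_im_characteristic {σ t s : ℝ} (hs : s ≤ t) {z m : ℂ}
    (hm : 0 ≤ z.im * m.im) : |z.im| ≤ |(characteristic σ t z m s).im| := by
  have him : (characteristic σ t z m s).im
      = Real.exp (t - s) * z.im + σ ^ 2 * (Real.exp (t - s) - Real.exp (s - t)) * m.im := by
    have : characteristic σ t z m s = ((Real.exp (t - s) : ℝ) : ℂ) * z
        + ((σ ^ 2 * (Real.exp (t - s) - Real.exp (s - t)) : ℝ) : ℂ) * m := by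
      unfold characteristic
      push_cast
      ring
    rw [this, Complex.add_im, Complex.im_ofReal_mul, Complex.im_ofReal_mul]
  have h₁ : 1 ≤ Real.exp (t - s) := Real.one_le_exp (by linarith)
  have h₂ : 0 ≤ σ ^ 2 * (Real.exp (t - s) - Real.exp (s - t)) :=
    mul_nonneg (sq_nonneg _) (sub_nonneg.mpr (Real.exp_le_exp.mpr (by linarith)))
  rw [him, ← sq_le_sq]
  generalize Real.exp (t - s) = a at *
  generalize σ ^ 2 * (a - Real.exp (s - t)) = b at *
  have h₃ : 0 ≤ a * b * (z.im * m.im) := by positivity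
  have h₄ : 0 ≤ (a ^ 2 - 1) * z.im ^ 2 := mul_nonneg (by nlinarith) (sq_nonneg _)
  nlinarith [sq_nonneg (b * m.im)]

theorem characteristic_stieltjes_mem_Omega (σ : ℝ) {s t : ℝ} (hs : s ≤ t)
    (μ : ProbabilityMeasure ℝ) {z : ℂ} (hz : z ∈ Omega) :
    characteristic σ t z (stieltjes μ z) s ∈ Omega :=
  abs_pos.mp ((abs_pos.mpr hz).trans_le
    (abs_im_le_abs_im_characteristic hs (im_mul_im_stieltjes_nonneg μ hz)))

/-- The solution is multiplied by `e^{s - t}` along the characteristic that ends at `(t, z)`. -/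
theorem IsLimitFamily.stieltjes_characteristic {σ : ℝ} {X₀ : ProbabilityMeasure ℝ}
    {X : ℝ → ProbabilityMeasure ℝ} (hX : IsLimitFamily σ X₀ X) {s t : ℝ} (hs : 0 ≤ s)
    (hst : s ≤ t) {z : ℂ} (hz : z ∈ Omega) :
    stieltjes (X s) (characteristic σ t z (stieltjes (X t) z) s)
      = stieltjes (X t) z * (Real.exp (s - t) : ℂ) := by
  set m := stieltjes (X t) z with hm
  set ζ := characteristic σ t z m with hζ
  have hz' : 0 < |z.im| := abs_pos.mpr hz
  have him : ∀ r ≤ t, |z.im| ≤ |(ζ r).im| := fun r hr =>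
    abs_im_le_abs_im_characteristic hr (im_mul_im_stieltjes_nonneg _ hz)
  have hΩ : ∀ r ≤ t, ζ r ∈ Omega := fun r hr =>
    characteristic_stieltjes_mem_Omega σ hr (X t) hz
  have hζc : Continuous ζ :=
    continuous_iff_continuousAt.mpr fun r => (hasDerivAt_characteristic σ t z m r).continuousAt
  let φ : ℝ → ℂ := fun r => stieltjes (X r) (ζ r) - m * (Real.exp (r - t) : ℂ)
  let c : ℝ → ℂ := fun r => 2 * (σ : ℂ) ^ 2 * stieltjesDivDiff (X r) (ζ r) (ζ r) + 1
  -- The deviation `φ` satisfies a homogeneous linear equation with bounded coefficient `c`.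
  have hφ : ∀ r, 0 < r → r ≤ t → HasDerivAt φ (c r * φ r) r := fun r hr hrt => by
    have hY : ∀ w ∈ Omega, ContinuousAt (fun q => stieltjes (X q) w) r := fun w hw =>
      (hX.equation r hr w hw).continuousAt
    have h₁ := hasDerivAt_stieltjes_comp hY (hasDerivAt_characteristic σ t z m r) (hΩ r hrt)
      (hX.equation r hr _ (hΩ r hrt))
    refine (h₁.sub ((hasDerivAt_ofReal_exp_sub t r).const_mul m)).congr_deriv ?_
    rw [(hasDerivAt_stieltjes (X r) (hΩ r hrt)).deriv]
    simp only [φ, c, hζ]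
    ring
  have hc : ∀ r ≤ t, ‖c r‖ ≤ 2 * σ ^ 2 * (1 / (|z.im| * |z.im|)) + 1 := fun r hr => by
    have h₁ := norm_stieltjesDivDiff_le (X r) (hΩ r hr) (hΩ r hr)
    have h₂ : 1 / (|(ζ r).im| * |(ζ r).im|) ≤ 1 / (|z.im| * |z.im|) := by
      have := him r hr
      gcongr
    refine (norm_add_le _ _).trans ?_
    rw [norm_mul, norm_one]
    have : ‖2 * (σ : ℂ) ^ 2‖ = 2 * σ ^ 2 := by simp
    rw [this]
    have := h₁.trans h₂
    gcongr
  -- At time `0` only one-sided continuity in time is available.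
  have hcont : ContinuousOn φ (Set.Icc 0 t) := by
    intro r hr
    rcases hr.1.eq_or_lt with h0 | h0
    · subst h0
      have hζ0 : Tendsto ζ (𝓝[Set.Icc 0 t] 0) (𝓝 (ζ 0)) :=
        hζc.continuousAt.tendsto.mono_left nhdsWithin_le_nhds
      have hM : Tendsto (fun r => stieltjes (X r) (ζ 0)) (𝓝[Set.Icc 0 t] 0)
          (𝓝 (stieltjes (X 0) (ζ 0))) :=
        (hX.continuousOn _ (hΩ 0 hr.2) 0 Set.self_mem_Ici).mono_left
          (nhdsWithin_mono _ Set.Icc_subset_Ici_self)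
      have hdiff : Tendsto (fun r => stieltjes (X r) (ζ r) - stieltjes (X r) (ζ 0))
          (𝓝[Set.Icc 0 t] 0) (𝓝 0) := by
        have hlim : Tendsto (fun r => ‖ζ r - ζ 0‖ * (1 / (|z.im| * |z.im|)))
            (𝓝[Set.Icc 0 t] 0) (𝓝 0) := by
          simpa using (hζ0.sub_const (ζ 0)).norm.mul_const (1 / (|z.im| * |z.im|))
        refine squeeze_zero_norm' ?_ hlim
        filter_upwards [self_mem_nhdsWithin] with q hq
        rw [stieltjes_sub _ (hΩ 0 hr.2) (hΩ q hq.2), norm_mul]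
        refine mul_le_mul_of_nonneg_left
          ((norm_stieltjesDivDiff_le _ (hΩ 0 hr.2) (hΩ q hq.2)).trans ?_) (norm_nonneg _)
        have h₁ := him 0 hr.2
        have h₂ := him q hq.2
        gcongr
      have hsum := hdiff.add hM
      simp only [sub_add_cancel, zero_add] at hsum
      exact hsum.sub (((hasDerivAt_ofReal_exp_sub t 0).continuousAt.tendsto.mono_left
        nhdsWithin_le_nhds).const_mul m)
    · exact (hφ r h0 hr.2).continuousAt.continuousWithinAt
  -- Time reversal turns the condition `φ t = 0` into an initial condition.
  have hrev : φ (t - (t - s)) = 0 := by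
    refine eq_zero_of_abs_deriv_le_mul_abs_self_of_eq_zero_right
      (f := fun r => φ (t - r)) (f' := fun r => -(c (t - r) * φ (t - r)))
      (K := 2 * σ ^ 2 * (1 / (|z.im| * |z.im|)) + 1) (a := 0) (b := t) ?_ ?_ ?_ ?_
      (t - s) ⟨by linarith, by linarith⟩
    · exact hcont.comp (by fun_prop) fun r hr => ⟨by linarith [hr.2], by linarith [hr.1]⟩
    · intro r hr
      have h₁ := (hφ (t - r) (by linarith [hr.2]) (by linarith [hr.1])).scomp r
        ((hasDerivAt_id r).const_sub t)
      exact (h₁.congr_deriv (by simp)).hasDerivWithinAt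
    · simp [φ, hζ, hm, characteristic]
    · intro r hr
      rw [norm_neg, norm_mul]
      exact mul_le_mul_of_nonneg_right (hc _ (by linarith [hr.1])) (norm_nonneg _)
  rw [sub_sub_cancel] at hrev
  exact sub_eq_zero.mp hrev

/-! ### The maps as points on characteristics -/

theorem h_eq_characteristic (σ : ℝ) (X : ℝ → ProbabilityMeasure ℝ) (t : ℝ) (z : ℂ) :
    h σ X t z = characteristic σ t z (stieltjes (X t) z) 0 := by
  simp [h, characteristic, mul_comm z]

theorem IsLimitFamily.stieltjes_h {σ : ℝ} {X₀ : ProbabilityMeasure ℝ}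
    {X : ℝ → ProbabilityMeasure ℝ} (hX : IsLimitFamily σ X₀ X) {t : ℝ} (ht : 0 ≤ t) {z : ℂ}
    (hz : z ∈ Omega) :
    stieltjes X₀ (h σ X t z) = stieltjes (X t) z * (Real.exp (-t) : ℂ) := by
  have hmem : h σ X t z ∈ Omega := by
    rw [h_eq_characteristic]
    exact characteristic_stieltjes_mem_Omega σ ht (X t) hz
  rw [← hX.initial _ hmem, h_eq_characteristic, hX.stieltjes_characteristic le_rfl ht hz, zero_sub]

/-- The transition map from `t` back to `s` follows the characteristics. -/
theorem IsLimitFamily.hTrans_eq_characteristic {σ : ℝ} {X₀ : ProbabilityMeasure ℝ}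
    {X : ℝ → ProbabilityMeasure ℝ} (hX : IsLimitFamily σ X₀ X) {t : ℝ} (ht : 0 ≤ t) (s : ℝ)
    {z : ℂ} (hz : z ∈ Omega) :
    hTrans σ X₀ X t s z = characteristic σ t z (stieltjes (X t) z) s := by
  simp only [hTrans, Function.comp_apply, g, hX.stieltjes_h ht hz]
  simp only [h, characteristic, sub_eq_add_neg, Real.exp_add, Complex.ofReal_mul]
  ring

theorem h_characteristic (σ : ℝ) (X : ℝ → ProbabilityMeasure ℝ) {s t : ℝ} {z m : ℂ}
    (hm : stieltjes (X s) (characteristic σ t z m s) = m * (Real.exp (s - t) : ℂ)) :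
    h σ X s (characteristic σ t z m s) = characteristic σ t z m 0 := by
  have hexp : (Real.exp s : ℂ) * (Real.exp (-s) : ℂ) = 1 := by
    rw [← Complex.ofReal_mul, ← Real.exp_add, add_neg_cancel, Real.exp_zero, Complex.ofReal_one]
  rw [h, hm]
  simp only [characteristic, sub_eq_add_neg, Real.exp_add, Complex.ofReal_mul, neg_zero, zero_add,
    Real.exp_zero, mul_one]
  linear_combination ((Real.exp t : ℂ) * z + (σ : ℂ) ^ 2 * (Real.exp t : ℂ) * m
    - (σ : ℂ) ^ 2 * (Real.exp (-t) : ℂ) * m) * hexp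

end DysonFlow

end

theorem proposition2p2 (σ : ℝ) (X₀ : MeasureTheory.ProbabilityMeasure ℝ)
    (X : ℝ → MeasureTheory.ProbabilityMeasure ℝ) (hX : DysonFlow.IsLimitFamily σ X₀ X) :
    (∀ t : ℝ, 0 ≤ t →
      Set.MapsTo (DysonFlow.h σ X t) DysonFlow.Omega DysonFlow.Omega ∧
      Set.EqOn (DysonFlow.g σ X₀ t ∘ DysonFlow.h σ X t) id DysonFlow.Omega) ∧
    (∀ t₁ t₂ : ℝ, 0 ≤ t₂ → t₂ ≤ t₁ →
      Set.MapsTo (DysonFlow.hTrans σ X₀ X t₁ t₂) DysonFlow.Omega DysonFlow.Omega ∧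
      Set.EqOn (DysonFlow.h σ X t₁)
        (DysonFlow.h σ X t₂ ∘ DysonFlow.hTrans σ X₀ X t₁ t₂) DysonFlow.Omega) := by
  refine ⟨fun t ht => ⟨fun z hz => ?_, fun z hz => ?_⟩,
    fun t s hs hst => ⟨fun z hz => ?_, fun z hz => ?_⟩⟩
  · rw [DysonFlow.h_eq_characteristic]
    exact DysonFlow.characteristic_stieltjes_mem_Omega σ ht (X t) hz
  · refine (hX.hTrans_eq_characteristic ht t hz).trans ?_
    simp [DysonFlow.characteristic]
  · rw [hX.hTrans_eq_characteristic (hs.trans hst) s hz]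
    exact DysonFlow.characteristic_stieltjes_mem_Omega σ hst (X t) hz
  · rw [Function.comp_apply, hX.hTrans_eq_characteristic (hs.trans hst) s hz,
      DysonFlow.h_characteristic σ X (hX.stieltjes_characteristic hs hst hz),
      DysonFlow.h_eq_characteristic]
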